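/- For $S \subseteq \omega$ the density of $S$ is $\rho(S)=\lim_n |S\cap\{0,\dots,n-1\}|/n$ when the limit exists. A set $D\subseteq\omega$ is a coarse description of $A\subseteq\omega$ if the symmetric difference $D\triangle A$ has density $0$, and $A$ is coarsely computable if it has a computable coarse description. We write $A\leq_{\mathrm{nc}}X$ if every coarse description of $X$ computes (i.e. Turing-computes) a coarse description of $A$. A class $\mathcal P\subseteq 2^\omega$ is a $\Pi^{0,A}_3$ class if there is an $A$-computable relation $R\subseteq\omega\times\omega\times 2^{<\omega}$ such that $Y\in\mathcal P \iff \forall a\,\exists b\,\forall c\; R(a,b,Y\upharpoonright c)$ for all $Y\in 2^\omega$; and $X$ is weakly $3$-random relative to $A$ if $X$ belongs to no $\Pi^{0,A}_3$ class of measure $0$ for the uniform measure on $2^\omega$ (sets are identified with their characteristic functions). Theorem. Let $A,X\subseteq\omega$. If $A$ is not coarsely computable and $X$ is weakly $3$-random relative to $A$, then there is no $X$-computable coarse description of $A$. In particular, $A\nleq_{\mathrm{nc}}X$. -/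

import Mathlib

open Filter Topology MeasureTheory

namespace CoarseReducibility

/-! ### Asymptotic density, coarse descriptions -/

/-- `ρₙ(S) = |S ∩ {0, …, n-1}| / n`, the density of `S` below `n`. -/
noncomputable def densityBelow (S : Set ℕ) (n : ℕ) : ℝ :=
  ((S ∩ Set.Iio n).ncard : ℝ) / (n : ℝ)

/-- `S` has (asymptotic) density `d`: the numbers `ρₙ(S)` converge to `d`. -/
def HasDensity (S : Set ℕ) (d : ℝ) : Prop :=
  Tendsto (densityBelow S) atTop (𝓝 d)

/-- `D` is a coarse description of `A`: the symmetric difference of `D` and `A` has density `0`. -/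
def IsCoarseDescription (D A : Set ℕ) : Prop :=
  HasDensity (symmDiff D A) 0

/-- `A` is coarsely computable: it has a computable coarse description. -/
def CoarselyComputable (A : Set ℕ) : Prop :=
  ∃ D : Set ℕ, ComputablePred (fun n => n ∈ D) ∧ IsCoarseDescription D A

/-! ### Sets as points of Cantor space and as oracles -/

open scoped Classical in
/-- The characteristic function of a set of natural numbers, a point of Cantor space. -/
noncomputable def chi (S : Set ℕ) : ℕ → Bool := fun n => decide (n ∈ S)

/-- The characteristic function of a set with values `0` and `1`, as an oracle. -/
noncomputable def oracle (S : Set ℕ) : ℕ →. ℕ := fun n => Part.some (chi S n).toNat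

/-- `B ≤_T C`: the set `B` is computable from the set `C`. -/
def SetTuringReducible (B C : Set ℕ) : Prop :=
  TuringReducible (oracle B) (oracle C)

/-- `B ≤_nc C`: every coarse description of `C` computes a coarse description of `B`. -/
def NonuniformlyCoarselyReducible (B C : Set ℕ) : Prop :=
  ∀ D : Set ℕ, IsCoarseDescription D C →
    ∃ E : Set ℕ, IsCoarseDescription E B ∧ SetTuringReducible E D

/-! ### Relative weak 3-randomness -/

/-- The uniform (fair coin) measure on Cantor space. -/
noncomputable def cantorMeasure : Measure (ℕ → Bool) :=
  Measure.infinitePi (fun _ : ℕ => (PMF.uniformOfFintype Bool).toMeasure)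

/-- The initial segment `Y(0) Y(1) … Y(c-1)` of `Y`, a binary string of length `c`. -/
def initSeg (Y : ℕ → Bool) (c : ℕ) : List Bool := (List.range c).map Y

/-- `P` is a `Π⁰₃` class relative to `A`: there is an `A`-computable relation `R` such that
`Y ∈ P ↔ ∀ a, ∃ b, ∀ c, R (a, b, Y↾c)`. -/
def IsPiThreeClass (A : Set ℕ) (P : Set (ℕ → Bool)) : Prop :=
  ∃ R : ℕ × ℕ × List Bool → Bool, ComputableIn {oracle A} R ∧
    ∀ Y : ℕ → Bool, Y ∈ P ↔ ∀ a : ℕ, ∃ b : ℕ, ∀ c : ℕ, R (a, b, initSeg Y c) = true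

/-- `X` is weakly `3`-random relative to `A`: it lies in no null `Π⁰₃` class relative to `A`
(equivalently, it lies in every `Σ⁰₃` class relative to `A` of measure `1`). -/
def WeaklyThreeRandom (X A : Set ℕ) : Prop :=
  ∀ P : Set (ℕ → Bool), IsPiThreeClass A P → cantorMeasure P = 0 → chi X ∉ P

end CoarseReducibility

/-! Suppose `X` computes a coarse description of `A`, through a functional given by a
prefix-monotone function `G` on initial segments. The `Y` along which `G` is total with an error set
of density `0` form a class `P`. It is `Π⁰₃` relative to `A` (`isPiThreeClass_descriptionClass`):
totality is `∀∃`, and density `0` is `∀∃∀` over approximations to the errors. Since `X` lies in `P`,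
weak `3`-randomness forces `P` to have positive measure.

Positive measure makes `A` coarsely computable (`coarselyComputable_of_measure_ne_zero`). Some
clopen `C` has more than `3/4` of its measure in `P` (`exists_prefixSet_of_pos`). To decide `m`,
search for a stage at which more than a third of the strings in `C` give `G` the same value at `m`,
and output such a value. The search halts because `G` converges at `m` on more than `3/4` of `C`, so
one value gets more than `3/8`. If the output is wrong, more than `1/3` of `C` errs at `m`, and less
than `1/4` of `C` lies outside `P`, so the errors fill at least `1/12` of `C` inside `P`.

Along each point of `P ∩ C` the errors have density `0`, so by dominated convergence their average
density tends to `0`. Each wrong output contributes a fixed amount to that average, hence the wrong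
outputs have density `0` (`hasDensity_zero_of_le_measureReal`).

The last claim follows because `X` is a coarse description of itself. -/

namespace CoarseReducibility

/-! ### Use functions of oracle computations -/

/-- A partial function of a binary string is prefix-monotone if its values persist under
extension of the string. -/
def PrefixMonotone {α : Type*} (F : List Bool → ℕ → Option α) : Prop :=
  ∀ ⦃σ τ : List Bool⦄, σ <+: τ → ∀ ⦃n : ℕ⦄ ⦃v : α⦄, F σ n = some v → F τ n = some v

lemma initSeg_succ (Y : ℕ → Bool) (c : ℕ) : initSeg Y (c + 1) = initSeg Y c ++ [Y c] := by
  simp [initSeg, List.range_succ]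

@[simp] lemma length_initSeg (Y : ℕ → Bool) (c : ℕ) : (initSeg Y c).length = c := by
  simp [initSeg]

lemma getElem?_initSeg (Y : ℕ → Bool) {c n : ℕ} (h : n < c) :
    (initSeg Y c)[n]? = some (Y n) := by
  simp [initSeg, h]

lemma initSeg_prefix (Y : ℕ → Bool) {s t : ℕ} (h : s ≤ t) : initSeg Y s <+: initSeg Y t := by
  induction t, h using Nat.le_induction with
  | base => exact List.prefix_rfl
  | succ t _ ih => exact ih.trans (by rw [initSeg_succ]; exact List.prefix_append _ _)

lemma PrefixMonotone.initSeg {α : Type*} {F : List Bool → ℕ → Option α} (hF : PrefixMonotone F)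
    {Y : ℕ → Bool} {s t n : ℕ} {v : α} (h : F (initSeg Y s) n = some v) (hst : s ≤ t) :
    F (initSeg Y t) n = some v :=
  hF (initSeg_prefix Y hst) h

/-- The primitive recursion of `F` and `H` along a fixed string. -/
def precUse (F H : List Bool → ℕ → Option ℕ) (τ : List Bool) (a n : ℕ) : Option ℕ :=
  n.rec (F τ a) fun y IH => IH.bind fun i => H τ (Nat.pair a (Nat.pair y i))

/-- The state after `k` steps of the search for a zero of `F τ (a, ·)`: it is `0` as long as no
zero has been found, and `j + 1` if `j` is the first zero. -/
def rfindState (F : List Bool → ℕ → Option ℕ) (τ : List Bool) (a k : ℕ) : Option ℕ :=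
  k.rec (some 0) fun y IH => IH.bind fun t =>
    t.casesOn ((F τ (Nat.pair a y)).map fun v => v.casesOn (y + 1) fun _ => 0) fun j => some (j + 1)

/-- The search for a zero of `F τ (a, ·)`, bounded by the length of the string. -/
def rfindUse (F : List Bool → ℕ → Option ℕ) (τ : List Bool) (a : ℕ) : Option ℕ :=
  (rfindState F τ a τ.length).bind fun t => t.casesOn none some

section Primrec

open Primrec

variable {F H : List Bool → ℕ → Option ℕ}

lemma primrec_precUse (hF : Primrec₂ F) (hH : Primrec₂ H) :
    Primrec₂ fun (τ : List Bool) (p : ℕ) => precUse F H τ p.unpair.1 p.unpair.2 := by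
  have hu : Primrec fun q : List Bool × ℕ => q.2.unpair := unpair.comp snd
  refine nat_rec' (f := fun q : List Bool × ℕ => q.2.unpair.2)
    (g := fun q => F q.1 q.2.unpair.1)
    (h := fun q (r : ℕ × Option ℕ) =>
      r.2.bind fun i => H q.1 (Nat.pair q.2.unpair.1 (Nat.pair r.1 i)))
    (snd.comp hu) (hF.comp fst (fst.comp hu)) ?_
  refine option_bind (snd.comp snd) ?_
  exact hH.comp (fst.comp (fst.comp fst))
    (Primrec₂.natPair.comp (fst.comp (hu.comp (fst.comp fst)))
      (Primrec₂.natPair.comp (fst.comp (snd.comp fst)) snd))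

lemma primrec_rfindUse (hF : Primrec₂ F) : Primrec₂ (rfindUse F) := by
  have hs : Primrec fun q : List Bool × ℕ => rfindState F q.1 q.2 q.1.length := by
    refine nat_rec' (f := fun q : List Bool × ℕ => q.1.length)
      (g := fun _ => some 0)
      (h := fun q (r : ℕ × Option ℕ) => r.2.bind fun t =>
        t.casesOn ((F q.1 (Nat.pair q.2 r.1)).map fun v => v.casesOn (r.1 + 1) fun _ => 0)
          fun j => some (j + 1))
      (list_length.comp fst) (const _) ?_
    refine option_bind (snd.comp snd) ?_
    refine nat_casesOn snd ?_ ?_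
    · refine option_map (hF.comp (fst.comp (fst.comp fst))
        (Primrec₂.natPair.comp (snd.comp (fst.comp fst)) (fst.comp (snd.comp fst)))) ?_
      exact nat_casesOn snd (succ.comp (fst.comp (snd.comp (fst.comp fst)))) (const 0).to₂
    · exact (option_some.comp (succ.comp snd)).to₂
  exact option_bind hs (nat_casesOn snd (const none) (option_some.comp snd).to₂)

end Primrec

section PrefixMonotone

variable {F H : List Bool → ℕ → Option ℕ}

lemma precUse_mono (hF : PrefixMonotone F) (hH : PrefixMonotone H) {σ τ : List Bool}
    (hστ : σ <+: τ) {a n v : ℕ} (h : precUse F H σ a n = some v) : precUse F H τ a n = some v := by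
  induction n generalizing v with
  | zero => exact hF hστ h
  | succ n ih =>
    obtain ⟨i, hi, hv⟩ := Option.bind_eq_some_iff.1 h
    exact Option.bind_eq_some_iff.2 ⟨i, ih hi, hH hστ hv⟩

lemma rfindState_mono (hF : PrefixMonotone F) {σ τ : List Bool} (hστ : σ <+: τ) {a k v : ℕ}
    (h : rfindState F σ a k = some v) : rfindState F τ a k = some v := by
  induction k generalizing v with
  | zero => exact h
  | succ k ih =>
    obtain ⟨t, ht, hv⟩ := Option.bind_eq_some_iff.1 h
    refine Option.bind_eq_some_iff.2 ⟨t, ih ht, ?_⟩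
    cases t with
    | zero =>
      obtain ⟨w, hw, rfl⟩ := Option.map_eq_some_iff.1 hv
      exact Option.map_eq_some_iff.2 ⟨w, hF hστ hw, rfl⟩
    | succ t => exact hv

/-- A longer string also allows a longer search, so `rfindUse` is prefix-monotone only because a
zero, once found, is never revised. -/
lemma rfindState_of_le {τ : List Bool} {a k l j : ℕ} (hkl : k ≤ l)
    (h : rfindState F τ a k = some (j + 1)) : rfindState F τ a l = some (j + 1) := by
  induction l, hkl using Nat.le_induction with
  | base => exact h
  | succ l _ ih => exact Option.bind_eq_some_iff.2 ⟨_, ih, rfl⟩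

lemma rfindUse_eq_some {τ : List Bool} {a v : ℕ} :
    rfindUse F τ a = some v ↔ rfindState F τ a τ.length = some (v + 1) := by
  rw [rfindUse, Option.bind_eq_some_iff]
  constructor
  · rintro ⟨t, ht, h⟩
    cases t with
    | zero => simp at h
    | succ t => simp only [Option.some.injEq] at h; rwa [← h]
  · exact fun h => ⟨_, h, rfl⟩

lemma rfindUse_mono (hF : PrefixMonotone F) : PrefixMonotone (rfindUse F) := by
  intro σ τ hστ a v h
  rw [rfindUse_eq_some] at h ⊢
  exact rfindState_of_le hστ.length_le (rfindState_mono hF hστ h)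

end PrefixMonotone

/-- Every function recursive in `X` is obtained from a primitive recursive prefix-monotone
function by evaluating it on the initial segments of `X`. -/
theorem exists_prefixMonotone_of_recursiveIn {X : Set ℕ} {f : ℕ →. ℕ}
    (hf : Nat.RecursiveIn {oracle X} f) :
    ∃ F : List Bool → ℕ → Option ℕ, Primrec₂ F ∧ PrefixMonotone F ∧
      ∀ n, ∀ v ∈ f n, ∃ s, F (initSeg (chi X) s) n = some v := by
  induction hf with
  | zero =>
    exact ⟨fun _ _ => some 0, Primrec₂.const _, fun _ _ _ _ _ h => h, fun n v hv =>
      ⟨0, by simpa using (Part.mem_some_iff.1 hv).symm⟩⟩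
  | succ =>
    refine ⟨fun _ n => some n.succ, (Primrec.option_some.comp (Primrec.succ.comp Primrec.snd)).to₂,
      fun _ _ _ _ _ h => h, fun n v hv => ⟨0, by simpa using (Part.mem_some_iff.1 hv).symm⟩⟩
  | left =>
    refine ⟨fun _ n => some n.unpair.1, (Primrec.option_some.comp (Primrec.fst.comp
      (Primrec.unpair.comp Primrec.snd))).to₂,
      fun _ _ _ _ _ h => h, fun n v hv => ⟨0, by simpa using (Part.mem_some_iff.1 hv).symm⟩⟩
  | right =>
    refine ⟨fun _ n => some n.unpair.2, (Primrec.option_some.comp (Primrec.snd.comp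
      (Primrec.unpair.comp Primrec.snd))).to₂,
      fun _ _ _ _ _ h => h, fun n v hv => ⟨0, by simpa using (Part.mem_some_iff.1 hv).symm⟩⟩
  | oracle g hg =>
    obtain rfl := Set.mem_singleton_iff.1 hg
    -- Bit `n` is visible only in strings longer than `n`, hence the stage `n + 1`.
    refine ⟨fun τ n => τ[n]?.map Bool.toNat, Primrec.option_map Primrec.list_getElem?
      ((Primrec.dom_finite Bool.toNat).comp Primrec.snd).to₂, ?_, fun n v hv => ⟨n + 1, ?_⟩⟩
    · intro σ τ hστ n v h
      obtain ⟨b, hb, rfl⟩ := Option.map_eq_some_iff.1 h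
      obtain ⟨l, rfl⟩ := hστ
      obtain ⟨hlt, -⟩ := List.getElem?_eq_some_iff.1 hb
      exact Option.map_eq_some_iff.2 ⟨b, (List.getElem?_append_left hlt).trans hb, rfl⟩
    · beta_reduce
      rw [getElem?_initSeg _ n.lt_succ_self, Part.mem_some_iff.1 hv]
      rfl
  | pair _ _ ihf ihh =>
    obtain ⟨F, hFp, hFm, hF⟩ := ihf
    obtain ⟨H, hHp, hHm, hH⟩ := ihh
    refine ⟨fun τ n => (F τ n).bind fun x => (H τ n).map fun y => Nat.pair x y, ?_, ?_, ?_⟩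
    · exact Primrec.option_bind hFp (Primrec.option_map (hHp.comp (Primrec.fst.comp Primrec.fst)
        (Primrec.snd.comp Primrec.fst)) (Primrec₂.natPair.comp (Primrec.snd.comp Primrec.fst)
          Primrec.snd))
    · intro σ τ hστ n v h
      obtain ⟨x, hx, h⟩ := Option.bind_eq_some_iff.1 h
      obtain ⟨y, hy, rfl⟩ := Option.map_eq_some_iff.1 h
      exact Option.bind_eq_some_iff.2 ⟨x, hFm hστ hx, Option.map_eq_some_iff.2
        ⟨y, hHm hστ hy, rfl⟩⟩
    · intro n v hv
      simp only [Seq.seq, Part.map_eq_map, Part.mem_bind_iff, Part.mem_map_iff] at hv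
      obtain ⟨_, ⟨x, hx, rfl⟩, y, hy, rfl⟩ := hv
      obtain ⟨s, hs⟩ := hF n x hx
      obtain ⟨t, ht⟩ := hH n y hy
      exact ⟨max s t, Option.bind_eq_some_iff.2 ⟨x, hFm.initSeg hs (le_max_left _ _),
        Option.map_eq_some_iff.2 ⟨y, hHm.initSeg ht (le_max_right _ _), rfl⟩⟩⟩
  | comp _ _ ihf ihh =>
    obtain ⟨F, hFp, hFm, hF⟩ := ihf
    obtain ⟨H, hHp, hHm, hH⟩ := ihh
    refine ⟨fun τ n => (H τ n).bind (F τ), ?_, ?_, ?_⟩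
    · exact Primrec.option_bind hHp (hFp.comp (Primrec.fst.comp Primrec.fst) Primrec.snd)
    · intro σ τ hστ n v h
      obtain ⟨x, hx, h⟩ := Option.bind_eq_some_iff.1 h
      exact Option.bind_eq_some_iff.2 ⟨x, hHm hστ hx, hFm hστ h⟩
    · intro n v hv
      obtain ⟨x, hx, hv⟩ := Part.mem_bind_iff.1 hv
      obtain ⟨s, hs⟩ := hF x v hv
      obtain ⟨t, ht⟩ := hH n x hx
      exact ⟨max s t, Option.bind_eq_some_iff.2 ⟨x, hHm.initSeg ht (le_max_right _ _),
        hFm.initSeg hs (le_max_left _ _)⟩⟩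
  | @prec f h _ _ ihf ihh =>
    obtain ⟨F, hFp, hFm, hF⟩ := ihf
    obtain ⟨H, hHp, hHm, hH⟩ := ihh
    refine ⟨_, primrec_precUse hFp hHp, fun σ τ hστ n v h => precUse_mono hFm hHm hστ h, ?_⟩
    intro p v hv
    simp only at hv ⊢
    generalize p.unpair.1 = a at hv ⊢
    generalize p.unpair.2 = n at hv ⊢
    induction n generalizing v with
    | zero => exact hF a v hv
    | succ n ih =>
      obtain ⟨i, hi, hv⟩ := Part.mem_bind_iff.1 hv
      obtain ⟨s, hs⟩ := ih i hi
      obtain ⟨t, ht⟩ := hH _ _ hv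
      exact ⟨max s t, Option.bind_eq_some_iff.2
        ⟨i, precUse_mono hFm hHm (initSeg_prefix _ (le_max_left _ _)) hs,
          hHm.initSeg ht (le_max_right _ _)⟩⟩
  | @rfind f _ ihf =>
    obtain ⟨F, hFp, hFm, hF⟩ := ihf
    refine ⟨_, primrec_rfindUse hFp, rfindUse_mono hFm, ?_⟩
    intro a v hv
    obtain ⟨hv, hlt⟩ := Nat.mem_rfind.1 hv
    -- Up to the least zero `v` the search only meets nonzero values; finitely many stages are
    -- merged by `max`.
    have key : ∀ k ≤ v, ∃ s, rfindState F (initSeg (chi X) s) a k = some 0 := by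
      intro k hk
      induction k with
      | zero => exact ⟨0, rfl⟩
      | succ k ih =>
        obtain ⟨s, hs⟩ := ih (by omega)
        obtain ⟨w, hw, hw0⟩ := (Part.mem_map_iff _).1 (hlt (m := k) (by omega))
        obtain ⟨t, ht⟩ := hF _ _ hw
        refine ⟨max s t, Option.bind_eq_some_iff.2
          ⟨0, rfindState_mono hFm (initSeg_prefix _ (le_max_left _ _)) hs, ?_⟩⟩
        refine Option.map_eq_some_iff.2 ⟨w, hFm.initSeg ht (le_max_right _ _), ?_⟩
        cases w with
        | zero => simp at hw0
        | succ w => rfl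
    obtain ⟨s, hs⟩ := key v le_rfl
    obtain ⟨w, hw, hw0⟩ := (Part.mem_map_iff _).1 hv
    obtain ⟨t, ht⟩ := hF _ _ hw
    obtain rfl : w = 0 := by simpa using hw0
    -- The string must have length at least `v + 1`, since its length bounds the search.
    have h1 : rfindState F (initSeg (chi X) (max (max s t) (v + 1))) a (v + 1) = some (v + 1) :=
      Option.bind_eq_some_iff.2
        ⟨0, rfindState_mono hFm (initSeg_prefix _ (by omega)) hs,
          Option.map_eq_some_iff.2 ⟨0, hFm.initSeg ht (by omega), rfl⟩⟩
    exact ⟨max (max s t) (v + 1), rfindUse_eq_some.2 (rfindState_of_le (by simp) h1)⟩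

/-- A set reducible to `X` is computed from the initial segments of `X` by a primitive recursive
prefix-monotone function. -/
theorem SetTuringReducible.exists_prefixMonotone {D X : Set ℕ} (h : SetTuringReducible D X) :
    ∃ G : List Bool → ℕ → Option Bool, Primrec₂ G ∧ PrefixMonotone G ∧
      ∀ n, ∃ s, G (initSeg (chi X) s) n = some (chi D n) := by
  obtain ⟨F, hFp, hFm, hF⟩ := exists_prefixMonotone_of_recursiveIn (RecursiveIn.iff_nat.1 h)
  refine ⟨fun τ n => (F τ n).map fun v => decide (v = 1), ?_, ?_, fun n => ?_⟩
  · exact Primrec.option_map hFp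
      ((Primrec.eq (α := ℕ)).decide.comp Primrec.snd (Primrec.const 1)).to₂
  · intro σ τ hστ n v h
    obtain ⟨w, hw, rfl⟩ := Option.map_eq_some_iff.1 h
    exact Option.map_eq_some_iff.2 ⟨w, hFm hστ hw, rfl⟩
  · obtain ⟨s, hs⟩ := hF n _ (Part.mem_some _)
    refine ⟨s, Option.map_eq_some_iff.2 ⟨_, hs, ?_⟩⟩
    cases chi D n <;> rfl

/-! ### Computations with initial segments of the oracle -/

/-- Primitive recursion on the length: the state is the code of the string so far, and each step
appends one oracle bit. -/
lemma recursiveIn_encode_initSeg (A : Set ℕ) :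
    Nat.RecursiveIn {oracle A}
      fun p => Part.some (Encodable.encode (initSeg (chi A) p.unpair.2)) := by
  let step : ℕ → ℕ := fun p => Encodable.encode
    (((Encodable.decode p.unpair.1 : Option (List Bool)).getD []) ++ [decide (p.unpair.2 = 1)])
  have hstep : Nat.RecursiveIn {oracle A} fun p => Part.some (step p) := by
    have : Primrec step := by
      refine Primrec.encode.comp (Primrec.list_concat.comp ?_ ?_)
      · exact Primrec.option_getD.comp (Primrec.decode.comp (Primrec.fst.comp Primrec.unpair))
          (Primrec.const [])
      · exact (Primrec.eq (α := ℕ)).decide.comp (Primrec.snd.comp Primrec.unpair) (Primrec.const 1)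
    exact (Primrec.nat_iff.1 this).recursiveIn
  have hproj : Nat.RecursiveIn {oracle A} fun p => Part.some p.unpair.2.unpair.2 :=
    (Primrec.nat_iff.1 (Primrec.snd.comp (Primrec.unpair.comp
      (Primrec.snd.comp Primrec.unpair)))).recursiveIn
  have hproj' : Nat.RecursiveIn {oracle A} fun p => Part.some p.unpair.2.unpair.1 :=
    (Primrec.nat_iff.1 (Primrec.fst.comp (Primrec.unpair.comp
      (Primrec.snd.comp Primrec.unpair)))).recursiveIn
  have hnil : Nat.RecursiveIn {oracle A}
      fun _ => Part.some (Encodable.encode ([] : List Bool)) :=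
    (Primrec.nat_iff.1 (Primrec.const (Encodable.encode ([] : List Bool)))).recursiveIn
  have h := hnil.prec (hstep.comp (hproj.pair
    ((Nat.RecursiveIn.oracle _ (Set.mem_singleton (oracle A))).comp hproj')))
  refine h.of_eq fun p => ?_
  simp only
  generalize p.unpair.2 = n
  induction n with
  | zero => rfl
  | succ n ih =>
    have hbit : (Part.some n >>= oracle A) = Part.some (chi A n).toNat := Part.bind_some _ _
    simp only [ih]
    simp only [Seq.seq, Part.map_eq_map, Part.bind_eq_bind, Part.bind_some, Part.map_some,
      Nat.unpair_pair, hbit, step, Encodable.encodek, initSeg_succ, Option.getD_some]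
    cases chi A n <;> rfl

/-- All oracle queries are gathered into one initial segment of computable length, so what remains
is an oracle-free computation. -/
theorem computableIn_initSeg {α σ : Type*} [Primcodable α] [Primcodable σ] (A : Set ℕ)
    {g : α × List Bool → σ} (hg : Computable g) {l : α → ℕ} (hl : Computable l) :
    ComputableIn {oracle A} fun a => g (a, initSeg (chi A) (l a)) := by
  have h1 : Nat.RecursiveIn {oracle A} fun n =>
      (((Encodable.decode n : Option α).map fun a => Nat.pair n (l a) : Option ℕ) : Part ℕ) := by
    refine Nat.Partrec.recursiveIn (Partrec.nat_iff.1 (Computable.ofOption ?_))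
    exact Computable.option_map Computable.decode
      (Primrec₂.natPair.to_comp.comp Computable.fst (hl.comp Computable.snd))
  have h2 : Nat.RecursiveIn {oracle A} fun p =>
      (((Encodable.decode p.unpair.1 : Option α).bind fun a =>
        (Encodable.decode p.unpair.2 : Option (List Bool)).map fun τ =>
          Encodable.encode (g (a, τ)) : Option ℕ) : Part ℕ) := by
    refine Nat.Partrec.recursiveIn (Partrec.nat_iff.1 (Computable.ofOption ?_))
    refine Computable.option_bind
      (Computable.decode.comp (Computable.fst.comp Computable.unpair)) ?_
    refine Computable.option_map
      (Computable.decode.comp (Computable.snd.comp (Computable.unpair.comp Computable.fst))) ?_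
    exact Computable.encode.comp
      (hg.comp (Computable.pair (Computable.snd.comp Computable.fst) Computable.snd))
  have h3 := (h2.comp (Nat.RecursiveIn.left.pair (recursiveIn_encode_initSeg A))).comp h1
  refine h3.of_eq fun n => ?_
  cases h : (Encodable.decode n : Option α) with
  | none => simp
  | some a => simp [Seq.seq, h]

/-! ### The density of a set of errors -/

lemma ncard_inter_Iio (S : Set ℕ) [DecidablePred (· ∈ S)] (n : ℕ) :
    (S ∩ Set.Iio n).ncard = (List.range n).countP (· ∈ S) := by
  have : S ∩ Set.Iio n = ↑((Finset.range n).filter (· ∈ S)) := by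
    ext m; simp [and_comm]
  rw [this, Set.ncard_coe_finset, ← Nat.count_eq_card_filter_range]
  rfl

/-- With `ε` replaced by `1 / a` and denominators cleared, the condition compares natural numbers
and is decidable from finite data. -/
lemma hasDensity_zero_iff (S : Set ℕ) :
    HasDensity S 0 ↔ ∀ a : ℕ, ∃ b : ℕ, ∀ n ≥ b, a * (S ∩ Set.Iio n).ncard ≤ n := by
  have nonneg (n : ℕ) : 0 ≤ densityBelow S n := by unfold densityBelow; positivity
  rw [HasDensity, Metric.tendsto_atTop]
  simp only [dist_zero_right, Real.norm_eq_abs, abs_of_nonneg (nonneg _)]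
  constructor
  · intro h a
    obtain ⟨b, hb⟩ := h (1 / (a + 1)) (by positivity)
    refine ⟨b, fun n hn => ?_⟩
    rcases Nat.eq_zero_or_pos n with rfl | hpos
    · simp
    · have := hb n hn
      have hn' : (0 : ℝ) < n := by exact_mod_cast hpos
      rw [densityBelow, div_lt_div_iff₀ hn' (by positivity)] at this
      have h' : (a : ℝ) * (S ∩ Set.Iio n).ncard ≤ n := by
        nlinarith [(Nat.cast_nonneg (S ∩ Set.Iio n).ncard : (0 : ℝ) ≤ _)]
      exact_mod_cast h'
  · intro h ε hε
    obtain ⟨a, ha⟩ := exists_nat_gt (1 / ε)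
    obtain ⟨b, hb⟩ := h a
    refine ⟨b + 1, fun n hn => ?_⟩
    have hn' : (0 : ℝ) < n := by exact_mod_cast (by omega : 0 < n)
    have ha0 : (0 : ℝ) < a := lt_trans (by positivity) ha
    have h' : (a : ℝ) * (S ∩ Set.Iio n).ncard ≤ n := by exact_mod_cast hb n (by omega)
    rw [densityBelow, div_lt_iff₀ hn']
    rw [div_lt_iff₀ hε] at ha
    have h2 : (n : ℝ) < a * (ε * n) := by nlinarith
    exact lt_of_mul_lt_mul_left (h'.trans_lt h2) ha0.le

/-- The arguments at which `G`, evaluated along `Y`, disagrees with `A`. -/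
def errorSet (G : List Bool → ℕ → Option Bool) (A : Set ℕ) (Y : ℕ → Bool) : Set ℕ :=
  {m | ∃ s, G (initSeg Y s) m = some (!chi A m)}

/-- The points along which `G` converges everywhere to a coarse description of `A`. -/
def descriptionClass (G : List Bool → ℕ → Option Bool) (A : Set ℕ) : Set (ℕ → Bool) :=
  {Y | (∀ m, ∃ s, (G (initSeg Y s) m).isSome) ∧ HasDensity (errorSet G A Y) 0}

/-- The number of errors of `G τ` below `n`, as compared with the initial segment `σ` of a set. -/
def errorCount (G : List Bool → ℕ → Option Bool) (τ σ : List Bool) (n : ℕ) : ℕ :=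
  (List.range n).countP fun m => decide (G τ m = σ[m]?.map not)

/-- The matrix of the `Π⁰₃` definition of `descriptionClass G A`. -/
def descriptionMatrix (G : List Bool → ℕ → Option Bool)
    (p : (ℕ × ℕ × List Bool) × List Bool) : Bool :=
  (decide (p.1.2.2.length < p.1.2.1) || (G p.1.2.2 p.1.1).isSome) &&
    (decide (p.1.2.2.length.unpair.1 < p.1.2.1) ||
      decide (p.1.1 * errorCount G p.1.2.2 p.2 p.1.2.2.length.unpair.1 ≤
        p.1.2.2.length.unpair.1))

lemma primrec_countP {α β : Type*} [Primcodable α] [Primcodable β] {f : α → List β}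
    {q : α → β → Bool} (hf : Primrec f) (hq : Primrec₂ q) :
    Primrec fun a => (f a).countP (q a) := by
  have h : Primrec fun a => ((f a).filterMap fun b => bif q a b then some b else none).length :=
    Primrec.list_length.comp (Primrec.listFilterMap hf
      (Primrec.cond hq (Primrec.option_some.comp Primrec.snd) (Primrec.const none)))
  refine h.of_eq fun a => ?_
  induction f a with
  | nil => rfl
  | cons b l ih => cases hb : q a b <;> simp [hb, ih]

lemma primrec_errorCount {G : List Bool → ℕ → Option Bool} (hG : Primrec₂ G) :
    Primrec fun p : (List Bool × List Bool) × ℕ => errorCount G p.1.1 p.1.2 p.2 := by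
  have h1 : Primrec fun p : ((List Bool × List Bool) × ℕ) × ℕ => G p.1.1.1 p.2 :=
    hG.comp (Primrec.fst.comp (Primrec.fst.comp Primrec.fst)) Primrec.snd
  have h2 : Primrec fun p : ((List Bool × List Bool) × ℕ) × ℕ => p.1.1.2[p.2]?.map not :=
    Primrec.option_map (Primrec.list_getElem?.comp (Primrec.snd.comp (Primrec.fst.comp Primrec.fst))
      Primrec.snd) (Primrec.not.comp Primrec.snd).to₂
  have h3 : Primrec₂ fun (p : (List Bool × List Bool) × ℕ) (m : ℕ) =>
      decide (G p.1.1 m = p.1.2[m]?.map not) := (Primrec.eq (α := Option Bool)).decide.comp h1 h2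
  exact primrec_countP (Primrec.list_range.comp Primrec.snd) h3

lemma primrec_descriptionMatrix {G : List Bool → ℕ → Option Bool} (hG : Primrec₂ G) :
    Primrec (descriptionMatrix G) := by
  have ha : Primrec fun p : (ℕ × ℕ × List Bool) × List Bool => p.1.1 :=
    Primrec.fst.comp Primrec.fst
  have hb : Primrec fun p : (ℕ × ℕ × List Bool) × List Bool => p.1.2.1 :=
    Primrec.fst.comp (Primrec.snd.comp Primrec.fst)
  have ht : Primrec fun p : (ℕ × ℕ × List Bool) × List Bool => p.1.2.2 :=
    Primrec.snd.comp (Primrec.snd.comp Primrec.fst)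
  have hl := Primrec.list_length.comp ht
  have hn := Primrec.fst.comp (Primrec.unpair.comp hl)
  have hcount : Primrec fun p : (ℕ × ℕ × List Bool) × List Bool =>
      errorCount G p.1.2.2 p.2 p.1.2.2.length.unpair.1 :=
    (primrec_errorCount hG).comp (Primrec.pair (Primrec.pair ht Primrec.snd) hn)
  have h1 : Primrec fun p : (ℕ × ℕ × List Bool) × List Bool =>
      decide (p.1.2.2.length < p.1.2.1) := Primrec.nat_lt.decide.comp hl hb
  have h2 : Primrec fun p : (ℕ × ℕ × List Bool) × List Bool => (G p.1.2.2 p.1.1).isSome :=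
    Primrec.option_isSome.comp (hG.comp ht ha)
  have h3 : Primrec fun p : (ℕ × ℕ × List Bool) × List Bool =>
      decide (p.1.2.2.length.unpair.1 < p.1.2.1) := Primrec.nat_lt.decide.comp hn hb
  have h4 : Primrec fun p : (ℕ × ℕ × List Bool) × List Bool =>
      decide (p.1.1 * errorCount G p.1.2.2 p.2 p.1.2.2.length.unpair.1 ≤
        p.1.2.2.length.unpair.1) :=
    Primrec.nat_le.decide.comp (Primrec.nat_mul.comp ha hcount) hn
  exact Primrec.and.comp (Primrec.or.comp h1 h2) (Primrec.or.comp h3 h4)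

section

variable {G : List Bool → ℕ → Option Bool} {A : Set ℕ} {Y : ℕ → Bool}

/-- The bound `n ≤ c` matters: beyond the end of the string for `A` both sides could be `none`, and
an undefined value would count as an error. -/
lemma decide_initSeg_iff {c n m : ℕ} (hn : n ≤ c) (hm : m < n) :
    decide (G (initSeg Y c) m = (initSeg (chi A) c)[m]?.map not) = true ↔
      G (initSeg Y c) m = some (!chi A m) := by
  rw [getElem?_initSeg _ (by omega), decide_eq_true_iff, Option.map_some]

open scoped Classical in
lemma errorCount_le {c n : ℕ} (hn : n ≤ c) :
    errorCount G (initSeg Y c) (initSeg (chi A) c) n ≤ (errorSet G A Y ∩ Set.Iio n).ncard := by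
  rw [ncard_inter_Iio]
  refine List.countP_mono_left fun m hm h => ?_
  exact decide_eq_true ⟨c, (decide_initSeg_iff hn (List.mem_range.1 hm)).1 h⟩

-- Only finitely many errors lie below `n`, so one stage reveals them all.
open scoped Classical in
lemma exists_ncard_le_errorCount (hG : PrefixMonotone G) (n : ℕ) :
    ∃ c₀, ∀ c ≥ c₀, n ≤ c → (errorSet G A Y ∩ Set.Iio n).ncard ≤
      errorCount G (initSeg Y c) (initSeg (chi A) c) n := by
  have key : ∀ m, ∃ s, m ∈ errorSet G A Y → G (initSeg Y s) m = some (!chi A m) := fun m => by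
    by_cases h : m ∈ errorSet G A Y
    · exact h.imp fun s hs _ => hs
    · exact ⟨0, fun h' => absurd h' h⟩
  choose s hs using key
  refine ⟨(Finset.range n).sup s, fun c hc hn => ?_⟩
  rw [ncard_inter_Iio]
  refine List.countP_mono_left fun m hm h => ?_
  have hm' := List.mem_range.1 hm
  exact (decide_initSeg_iff hn hm').2 (hG.initSeg (hs m (of_decide_eq_true h))
    ((Finset.le_sup (Finset.mem_range.2 hm')).trans hc))

/-- The length `c` is both the stage and, through `c.unpair.1`, the place where the density is
tested, so every place is tested at arbitrarily late stages. Early stages can only undercount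
errors, so they never refute a true bound. -/
lemma mem_descriptionClass_iff (hG : PrefixMonotone G) : Y ∈ descriptionClass G A ↔
    ∀ a, ∃ b, ∀ c, descriptionMatrix G ((a, b, initSeg Y c), initSeg (chi A) c) = true := by
  simp only [descriptionClass, Set.mem_ofPred_eq, hasDensity_zero_iff, descriptionMatrix,
    length_initSeg, Bool.and_eq_true, Bool.or_eq_true, decide_eq_true_eq]
  constructor
  · rintro ⟨htot, hden⟩ a
    obtain ⟨s, hs⟩ := htot a
    obtain ⟨b, hb⟩ := hden a
    obtain ⟨v, hv⟩ := Option.isSome_iff_exists.1 hs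
    refine ⟨max s b, fun c => ⟨?_, ?_⟩⟩
    · rcases lt_or_ge c (max s b) with h | h
      · exact Or.inl h
      · exact Or.inr (by rw [hG.initSeg hv (le_of_max_le_left h)]; rfl)
    · rcases lt_or_ge c.unpair.1 (max s b) with h | h
      · exact Or.inl h
      · exact Or.inr ((Nat.mul_le_mul_left a (errorCount_le (Nat.unpair_left_le c))).trans
          (hb _ (le_of_max_le_right h)))
  · intro h
    refine ⟨fun a => ?_, fun a => ?_⟩
    · obtain ⟨b, hb⟩ := h a
      exact ⟨b, (hb b).1.resolve_left (lt_irrefl b)⟩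
    · obtain ⟨b, hb⟩ := h a
      refine ⟨b, fun n hn => ?_⟩
      -- The length `Nat.pair n c₀` tests the density at `n` at a stage past `c₀`, where the count
      -- is complete.
      obtain ⟨c₀, hc₀⟩ := exists_ncard_le_errorCount (A := A) (Y := Y) hG n
      have h1 := (hb (Nat.pair n c₀)).2
      rw [Nat.unpair_pair] at h1
      exact (Nat.mul_le_mul_left a (hc₀ _ (Nat.right_le_pair n c₀) (Nat.left_le_pair n c₀))).trans
        (h1.resolve_left (not_lt.2 hn))

theorem isPiThreeClass_descriptionClass (hG : Primrec₂ G) (hm : PrefixMonotone G) :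
    IsPiThreeClass A (descriptionClass G A) := by
  refine ⟨fun q => descriptionMatrix G (q, initSeg (chi A) q.2.2.length),
    computableIn_initSeg A (primrec_descriptionMatrix hG).to_comp
      (Primrec.list_length.comp (Primrec.snd.comp Primrec.snd)).to_comp, fun Y => ?_⟩
  simpa only [length_initSeg] using mem_descriptionClass_iff hm

end

/-! ### Measurability -/

lemma measurableSet_initSeg (q : List Bool → Bool) (c : ℕ) :
    MeasurableSet {Y : ℕ → Bool | q (initSeg Y c) = true} := by
  induction c generalizing q with
  | zero => exact MeasurableSet.const (q [] = true)
  | succ c ih =>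
    have : {Y : ℕ → Bool | q (initSeg Y (c + 1)) = true} =
        ⋃ b : Bool, {Y : ℕ → Bool | q (initSeg Y c ++ [b]) = true} ∩ (fun Y => Y c) ⁻¹' {b} := by
      ext Y; simp [initSeg_succ]
    rw [this]
    exact MeasurableSet.iUnion fun b => (ih fun τ => q (τ ++ [b])).inter
      (measurable_pi_apply c (measurableSet_singleton b))

theorem IsPiThreeClass.measurableSet {A : Set ℕ} {P : Set (ℕ → Bool)} (h : IsPiThreeClass A P) :
    MeasurableSet P := by
  obtain ⟨R, -, hR⟩ := h
  have : P = ⋂ a : ℕ, ⋃ b : ℕ, ⋂ c : ℕ, {Y | R (a, b, initSeg Y c) = true} := by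
    ext Y; simp [hR]
  rw [this]
  exact MeasurableSet.iInter fun a => MeasurableSet.iUnion fun b => MeasurableSet.iInter fun c =>
    measurableSet_initSeg (fun τ => R (a, b, τ)) c

/-! ### The uniform measure of finite unions of basic open sets -/

instance : IsProbabilityMeasure cantorMeasure := by
  unfold cantorMeasure; infer_instance

lemma cantorMeasure_initSeg_eq (τ : List Bool) :
    cantorMeasure {Y | initSeg Y τ.length = τ} = 2⁻¹ ^ τ.length := by
  have h : {Y : ℕ → Bool | initSeg Y τ.length = τ} =
      Set.pi ↑(Finset.range τ.length) fun i => {τ.getD i false} := by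
    ext Y
    simp only [Set.mem_ofPred_eq, Set.mem_pi, Finset.coe_range, Set.mem_Iio,
      Set.mem_singleton_iff]
    constructor
    · intro hY i hi
      have := getElem?_initSeg Y hi
      rw [hY] at this
      simp [List.getD, this]
    · intro hY
      refine List.ext_getElem (by simp) fun i h1 h2 => ?_
      simpa [initSeg, List.getD, h2] using hY i h2
  have hb (b : Bool) : (PMF.uniformOfFintype Bool).toMeasure {b} = 2⁻¹ := by
    rw [PMF.toMeasure_apply_singleton _ _ (measurableSet_singleton b)]
    simp
  rw [h, cantorMeasure, Measure.infinitePi_pi _ fun i _ => measurableSet_singleton _]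
  simp [hb]

/-- The set of points whose initial segment of length `c` belongs to `l`. -/
def prefixSet (l : List (List Bool)) (c : ℕ) : Set (ℕ → Bool) := {Y | initSeg Y c ∈ l}

lemma measurableSet_prefixSet (l : List (List Bool)) (c : ℕ) : MeasurableSet (prefixSet l c) := by
  have := measurableSet_initSeg (fun τ => decide (τ ∈ l)) c
  simpa [prefixSet] using this

lemma measureReal_prefixSet {l : List (List Bool)} {c : ℕ} (hl : l.Nodup)
    (hc : ∀ τ ∈ l, τ.length = c) :
    cantorMeasure.real (prefixSet l c) = l.length * 2⁻¹ ^ c := by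
  induction l with
  | nil => simp [prefixSet]
  | cons τ l ih =>
    obtain ⟨hτ, hl⟩ := List.nodup_cons.1 hl
    obtain rfl := hc τ (by simp)
    have hu : prefixSet (τ :: l) τ.length = {Y | initSeg Y τ.length = τ} ∪ prefixSet l τ.length := by
      ext Y; simp [prefixSet]
    have hd : Disjoint {Y | initSeg Y τ.length = τ} (prefixSet l τ.length) := by
      refine Set.disjoint_left.2 fun Y (h1 : initSeg Y τ.length = τ) (h2 : _ ∈ l) => hτ ?_
      rwa [h1] at h2
    rw [hu, measureReal_union hd (measurableSet_prefixSet _ _),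
      ih hl fun σ hσ => hc σ (List.mem_cons_of_mem _ hσ), measureReal_def,
      cantorMeasure_initSeg_eq]
    simp
    ring

lemma initSeg_eq_iff {Y Z : ℕ → Bool} {c : ℕ} :
    initSeg Y c = initSeg Z c ↔ ∀ i < c, Y i = Z i := by
  simp [initSeg, List.map_inj_left]

/-- In every set of positive measure, some clopen set has relative measure above `3 / 4`. -/
theorem exists_prefixSet_of_pos {P : Set (ℕ → Bool)} (hP : MeasurableSet P)
    (hpos : cantorMeasure P ≠ 0) :
    ∃ (N : ℕ) (l : List (List Bool)), l.Nodup ∧ (∀ τ ∈ l, τ.length = N) ∧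
      3 / 4 * cantorMeasure.real (prefixSet l N) < cantorMeasure.real (P ∩ prefixSet l N) := by
  have hp : 0 < cantorMeasure.real P :=
    (measureReal_nonneg).lt_of_ne' ((measureReal_ne_zero_iff (measure_ne_top _ _)).2 hpos)
  -- With `p` the measure of `P` and error below `p / 8`, the clopen set meets `P` in more than `7p
  -- / 8` and has measure below `9p / 8`; and `3/4 * 9/8 < 7/8`.
  obtain ⟨t, ht, hlt⟩ := (Measure.MeasureDense.of_generateFrom_isSetAlgebra_finite cantorMeasure
    isSetAlgebra_measurableCylinders generateFrom_measurableCylinders.symm).approx P hP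
      (measure_ne_top _ _) (cantorMeasure.real P / 8) (by positivity)
  obtain ⟨s, S, -, rfl⟩ := (mem_measurableCylinders _).1 ht
  -- Length `s.sup id + 1` covers every coordinate on which the cylinder depends.
  have hfin : {τ | ∃ Y ∈ cylinder s S, initSeg Y (s.sup id + 1) = τ}.Finite :=
    (List.finite_length_eq Bool (s.sup id + 1)).subset (by rintro _ ⟨Y, -, rfl⟩; simp)
  have hcyl : prefixSet hfin.toFinset.toList (s.sup id + 1) = cylinder s S := by
    ext Y
    simp only [prefixSet, Set.mem_ofPred_eq, Finset.mem_toList, Set.Finite.mem_toFinset]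
    refine ⟨?_, fun h => ⟨Y, h, rfl⟩⟩
    rintro ⟨Z, hZ, hZY⟩
    rw [mem_cylinder] at hZ ⊢
    convert hZ using 1
    ext i
    exact (initSeg_eq_iff.1 hZY i (Nat.lt_succ_of_le (Finset.le_sup (f := id) i.2))).symm
  refine ⟨s.sup id + 1, hfin.toFinset.toList, Finset.nodup_toList _, ?_, ?_⟩
  · intro τ hτ
    obtain ⟨Y, -, rfl⟩ := hfin.mem_toFinset.1 (Finset.mem_toList.1 hτ)
    simp
  · rw [hcyl]
    have hm := MeasurableSet.of_mem_measurableCylinders ht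
    have hlt' : cantorMeasure.real (symmDiff P (cylinder s S)) < cantorMeasure.real P / 8 := by
      rw [measureReal_def]
      exact (ENNReal.lt_ofReal_iff_toReal_lt (measure_ne_top _ _)).1 hlt
    have h1 : cantorMeasure.real (P \ cylinder s S) ≤
        cantorMeasure.real (symmDiff P (cylinder s S)) :=
      measureReal_mono (by rw [Set.symmDiff_def]; exact Set.subset_union_left)
    have h2 : cantorMeasure.real (cylinder s S \ P) ≤
        cantorMeasure.real (symmDiff P (cylinder s S)) :=
      measureReal_mono (by rw [Set.symmDiff_def]; exact Set.subset_union_right)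
    have h3 := measureReal_inter_add_sdiff (μ := cantorMeasure) (s := P) hm
    have h4 := measureReal_inter_add_sdiff (μ := cantorMeasure) (s := cylinder s S) hP
    rw [Set.inter_comm] at h4
    linarith

/-! ### Extensions of strings -/

/-- The list of the extensions by `s` bits of the members of `l`. -/
def extensions (l : List (List Bool)) (s : ℕ) : List (List Bool) :=
  s.rec l fun _ IH => IH.flatMap fun τ => [τ ++ [false], τ ++ [true]]

lemma mem_extensions_succ {l : List (List Bool)} {s : ℕ} {τ : List Bool} :
    τ ∈ extensions l (s + 1) ↔ ∃ σ ∈ extensions l s, ∃ b, τ = σ ++ [b] := by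
  simp [extensions, List.mem_flatMap]

lemma length_extensions (l : List (List Bool)) (s : ℕ) :
    (extensions l s).length = l.length * 2 ^ s := by
  induction s with
  | zero => simp [extensions]
  | succ s ih =>
    have : (extensions l (s + 1)).length = (extensions l s).length * 2 := by
      simp [extensions, List.length_flatMap]
    rw [this, ih]; ring

lemma nodup_extensions {l : List (List Bool)} (hl : l.Nodup) (s : ℕ) : (extensions l s).Nodup := by
  induction s with
  | zero => exact hl
  | succ s ih =>
    refine List.nodup_flatMap.2 ⟨fun τ _ => by simp, ih.imp fun {σ τ} hne => ?_⟩
    rw [Function.onFun, List.disjoint_left]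
    intro ρ h1 h2
    simp only [List.mem_cons, List.not_mem_nil, or_false] at h1 h2
    rcases h1 with rfl | rfl <;> rcases h2 with h2 | h2 <;>
      exact hne (List.append_inj_left' h2 rfl)

lemma length_of_mem_extensions {l : List (List Bool)} {N : ℕ} (hl : ∀ τ ∈ l, τ.length = N) (s : ℕ) :
    ∀ τ ∈ extensions l s, τ.length = N + s := by
  induction s with
  | zero => exact hl
  | succ s ih =>
    intro τ hτ
    obtain ⟨σ, hσ, b, rfl⟩ := mem_extensions_succ.1 hτ
    simp [ih σ hσ, Nat.add_assoc]

lemma initSeg_mem_extensions {l : List (List Bool)} {N s : ℕ} {Y : ℕ → Bool} :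
    initSeg Y (N + s) ∈ extensions l s ↔ initSeg Y N ∈ l := by
  induction s with
  | zero => exact Iff.rfl
  | succ s ih =>
    rw [← ih, mem_extensions_succ, ← Nat.add_assoc, initSeg_succ]
    constructor
    · rintro ⟨σ, hσ, b, h⟩
      rwa [List.append_inj_left' h rfl]
    · exact fun h => ⟨_, h, _, rfl⟩

lemma primrec_extensions (l : List (List Bool)) : Primrec (extensions l) := by
  refine Primrec.nat_rec₁ l ?_
  refine Primrec.list_flatMap Primrec.snd ?_
  have h (b : Bool) : Primrec fun p : (ℕ × List (List Bool)) × List Bool => p.2 ++ [b] :=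
    Primrec.list_concat.comp Primrec.snd (Primrec.const b)
  exact Primrec.list_cons.comp (h false) (Primrec.list_cons.comp (h true) (Primrec.const []))

/-! ### Majority votes -/

/-- The number of extensions by `s` bits of members of `l` on which `G` takes the value `v`. -/
def voteCount (G : List Bool → ℕ → Option Bool) (l : List (List Bool)) (m s : ℕ) (v : Bool) : ℕ :=
  (extensions l s).countP fun τ => decide (G τ m = some v)

/-- A value taken by `G` on more than a third of the extensions by `s` bits of members of `l`. -/
def vote (G : List Bool → ℕ → Option Bool) (l : List (List Bool)) (m s : ℕ) : Option Bool :=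
  bif decide ((extensions l s).length < 3 * voteCount G l m s true) then some true
  else bif decide ((extensions l s).length < 3 * voteCount G l m s false) then some false
  else none

section

variable {G : List Bool → ℕ → Option Bool} {l : List (List Bool)} {N : ℕ}

lemma primrec_vote (hG : Primrec₂ G) : Primrec₂ (vote G l) := by
  have he : Primrec fun p : ℕ × ℕ => extensions l p.2 :=
    (primrec_extensions l).comp Primrec.snd
  have hv (v : Bool) : Primrec fun p : ℕ × ℕ => voteCount G l p.1 p.2 v := by
    refine primrec_countP he ?_
    have h1 : Primrec fun q : (ℕ × ℕ) × List Bool => G q.2 q.1.1 :=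
      hG.comp Primrec.snd (Primrec.fst.comp Primrec.fst)
    exact (Primrec.eq (α := Option Bool)).decide.comp h1 (Primrec.const (some v))
  have hlt (v : Bool) : Primrec fun p : ℕ × ℕ =>
      decide ((extensions l p.2).length < 3 * voteCount G l p.1 p.2 v) :=
    Primrec.nat_lt.decide.comp (Primrec.list_length.comp he)
      (Primrec.nat_mul.comp (Primrec.const 3) (hv v))
  exact Primrec.cond (hlt true) (Primrec.const _)
    (Primrec.cond (hlt false) (Primrec.const _) (Primrec.const _))

/-- Both values may pass the threshold; the preference for `true` is harmless because only this
bound is used. -/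
lemma lt_of_vote_eq_some {m s : ℕ} {v : Bool} (h : vote G l m s = some v) :
    (extensions l s).length < 3 * voteCount G l m s v := by
  rw [vote, Bool.cond_decide, Bool.cond_decide] at h
  split_ifs at h with h1 h2 <;> cases h <;> assumption

/-- If the two counts together exceed `3/4` of the total, one of them exceeds `3/8`, which is more
than `1/3`. -/
lemma isSome_vote {m s : ℕ} (h : 3 * (extensions l s).length <
    4 * (voteCount G l m s true + voteCount G l m s false)) : (vote G l m s).isSome := by
  rw [vote, Bool.cond_decide, Bool.cond_decide]
  split_ifs <;> simp
  omega

lemma measureReal_voteCount (hl : l.Nodup) (hN : ∀ τ ∈ l, τ.length = N) (m s : ℕ) (v : Bool) :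
    cantorMeasure.real (prefixSet l N ∩ {Y | G (initSeg Y (N + s)) m = some v}) =
      voteCount G l m s v * 2⁻¹ ^ (N + s) := by
  have h : prefixSet l N ∩ {Y | G (initSeg Y (N + s)) m = some v} =
      prefixSet ((extensions l s).filter fun τ => decide (G τ m = some v)) (N + s) := by
    ext Y; simp [prefixSet, initSeg_mem_extensions]
  rw [h, measureReal_prefixSet ((nodup_extensions hl s).filter _)
    fun τ hτ => length_of_mem_extensions hN s τ (List.mem_of_mem_filter hτ), voteCount,
    List.countP_eq_length_filter]

lemma measureReal_prefixSet_eq (hl : l.Nodup) (hN : ∀ τ ∈ l, τ.length = N) (s : ℕ) :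
    cantorMeasure.real (prefixSet l N) = (extensions l s).length * 2⁻¹ ^ (N + s) := by
  rw [measureReal_prefixSet hl hN, length_extensions]
  push_cast
  rw [pow_add, mul_mul_mul_comm, ← mul_pow]
  norm_num

/-- The sets where `G` has converged at `m` by stage `s` increase to a set containing `P ∩ C`, where
`C` is `prefixSet l N`. By continuity from below, one of them already has more than `3/4` of the
measure of `C`. -/
lemma exists_isSome_vote (hG : PrefixMonotone G) (hl : l.Nodup) (hN : ∀ τ ∈ l, τ.length = N)
    {P : Set (ℕ → Bool)} {m : ℕ} (hP : ∀ Y ∈ P, ∃ s, (G (initSeg Y s) m).isSome)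
    (h : 3 / 4 * cantorMeasure.real (prefixSet l N) < cantorMeasure.real (P ∩ prefixSet l N)) :
    ∃ s, (vote G l m s).isSome := by
  let U : ℕ → Set (ℕ → Bool) := fun s => prefixSet l N ∩ {Y | (G (initSeg Y (N + s)) m).isSome}
  have hU : Monotone U := by
    rintro s t hst Y ⟨hY, hs⟩
    obtain ⟨v, hv⟩ := Option.isSome_iff_exists.1 hs
    exact ⟨hY, Option.isSome_iff_exists.2 ⟨v, hG.initSeg hv (Nat.add_le_add_left hst N)⟩⟩
  have hsub : P ∩ prefixSet l N ⊆ ⋃ s, U s := by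
    rintro Y ⟨hYP, hY⟩
    obtain ⟨s, hs⟩ := hP Y hYP
    obtain ⟨v, hv⟩ := Option.isSome_iff_exists.1 hs
    exact Set.mem_iUnion.2 ⟨s, hY, Option.isSome_iff_exists.2
      ⟨v, hG.initSeg hv (Nat.le_add_left s N)⟩⟩
  have hlim : Tendsto (fun s => cantorMeasure.real (U s)) atTop
      (𝓝 (cantorMeasure.real (⋃ s, U s))) :=
    (ENNReal.tendsto_toReal (measure_ne_top _ _)).comp (tendsto_measure_iUnion_atTop hU)
  obtain ⟨s, hs⟩ := (hlim.eventually_const_lt (h.trans_le (measureReal_mono hsub))).exists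
  refine ⟨s, isSome_vote ?_⟩
  have hle : cantorMeasure.real (U s) ≤
      voteCount G l m s true * 2⁻¹ ^ (N + s) + voteCount G l m s false * 2⁻¹ ^ (N + s) := by
    rw [← measureReal_voteCount hl hN, ← measureReal_voteCount hl hN]
    refine (measureReal_mono ?_).trans (measureReal_union_le _ _)
    rintro Y ⟨hY, hYs⟩
    obtain ⟨v, hv⟩ := Option.isSome_iff_exists.1 hYs
    cases v
    · exact Or.inr ⟨hY, hv⟩
    · exact Or.inl ⟨hY, hv⟩
  rw [measureReal_prefixSet_eq hl hN s] at hs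
  have hpos : (0 : ℝ) < 2⁻¹ ^ (N + s) := by positivity
  have : (3 * (extensions l s).length : ℝ) <
      4 * (voteCount G l m s true + voteCount G l m s false) := by
    refine lt_of_mul_lt_mul_right ?_ hpos.le
    linarith
  exact_mod_cast this

/-- The constant is `1/12 = 1/3 - 1/4`: the share voting wrongly, less the share possibly outside
`P`. -/
lemma measureReal_errorSet_of_vote {A : Set ℕ} (hl : l.Nodup) (hN : ∀ τ ∈ l, τ.length = N)
    {P : Set (ℕ → Bool)} (hP : MeasurableSet P)
    (h : 3 / 4 * cantorMeasure.real (prefixSet l N) < cantorMeasure.real (P ∩ prefixSet l N))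
    {m s : ℕ} (hv : vote G l m s = some (!chi A m)) :
    cantorMeasure.real (prefixSet l N) / 12 ≤
      cantorMeasure.real ((P ∩ prefixSet l N) ∩ {Y | m ∈ errorSet G A Y}) := by
  set V := prefixSet l N ∩ {Y | G (initSeg Y (N + s)) m = some (!chi A m)} with hV
  have h1 : cantorMeasure.real (prefixSet l N) ≤ 3 * cantorMeasure.real V := by
    rw [hV, measureReal_voteCount hl hN, measureReal_prefixSet_eq hl hN s, ← mul_assoc]
    refine mul_le_mul_of_nonneg_right ?_ (by positivity)
    exact_mod_cast (lt_of_vote_eq_some hv).le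
  have h2 := measureReal_inter_add_sdiff (μ := cantorMeasure) (s := V) hP
  have h3 : cantorMeasure.real (V \ P) ≤ cantorMeasure.real (prefixSet l N \ P) :=
    measureReal_mono (Set.sdiff_subset_sdiff_left Set.inter_subset_left)
  have h4 := measureReal_inter_add_sdiff (μ := cantorMeasure) (s := prefixSet l N) hP
  rw [Set.inter_comm] at h4
  have h5 : cantorMeasure.real (V ∩ P) ≤
      cantorMeasure.real ((P ∩ prefixSet l N) ∩ {Y | m ∈ errorSet G A Y}) :=
    measureReal_mono fun Y hY => ⟨⟨hY.2, hY.1.1⟩, N + s, hY.1.2⟩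
  linarith

end

lemma measurableSet_mem_errorSet (G : List Bool → ℕ → Option Bool) (A : Set ℕ) (m : ℕ) :
    MeasurableSet {Y | m ∈ errorSet G A Y} := by
  have : {Y | m ∈ errorSet G A Y} =
      ⋃ s, {Y | decide (G (initSeg Y s) m = some (!chi A m)) = true} := by
    ext Y; simp [errorSet]
  rw [this]
  exact MeasurableSet.iUnion fun s =>
    measurableSet_initSeg (fun τ => decide (G τ m = some (!chi A m))) s

/-! ### Averaging the density of errors over a class -/

open scoped Classical in
lemma densityBelow_eq_sum (S : Set ℕ) (n : ℕ) :
    densityBelow S n = (∑ m ∈ Finset.range n, if m ∈ S then (1 : ℝ) else 0) / n := by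
  rw [densityBelow, ncard_inter_Iio, ← Finset.sum_filter, Finset.sum_const, nsmul_one,
    ← Nat.count_eq_card_filter_range]
  rfl

/-- If the random set `{m | Y ∈ W m}` has density `0` for all `Y` in `Q`, then so does every set
of numbers `m` for which the measure of `Q ∩ W m` is bounded away from `0`. -/
theorem hasDensity_zero_of_le_measureReal {Ω : Type*} [MeasurableSpace Ω] {μ : Measure Ω}
    [IsFiniteMeasure μ] {Q : Set Ω} (hQ : MeasurableSet Q) {W : ℕ → Set Ω}
    (hW : ∀ m, MeasurableSet (W m)) (hd : ∀ Y ∈ Q, HasDensity {m | Y ∈ W m} 0) {S : Set ℕ}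
    {δ : ℝ} (hδ : 0 < δ) (hS : ∀ m ∈ S, δ ≤ μ.real (Q ∩ W m)) : HasDensity S 0 := by
  classical
  have hsum (n : ℕ) (Y : Ω) : densityBelow {m | Y ∈ W m} n =
      (∑ m ∈ Finset.range n, (W m).indicator (fun _ => (1 : ℝ)) Y) / n := by
    rw [densityBelow_eq_sum]
    simp [Set.indicator_apply]
  have hmeas (n : ℕ) : Measurable fun Y => densityBelow {m | Y ∈ W m} n := by
    simp only [hsum]
    exact (Finset.measurable_fun_sum _ fun m _ => measurable_const.indicator (hW m)).div_const _
  have hint (n : ℕ) : ∫ Y in Q, densityBelow {m | Y ∈ W m} n ∂μ =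
      (∑ m ∈ Finset.range n, μ.real (Q ∩ W m)) / n := by
    simp only [hsum]
    rw [integral_div, integral_finsetSum _ fun m _ => (integrable_const _).indicator (hW m)]
    congr 1
    refine Finset.sum_congr rfl fun m _ => ?_
    rw [integral_indicator_const _ (hW m), measureReal_restrict_apply (hW m), Set.inter_comm]
    simp
  -- Densities are bounded by `1`, so dominated convergence applies on the finite measure space.
  have hlim : Tendsto (fun n => ∫ Y in Q, densityBelow {m | Y ∈ W m} n ∂μ) atTop (𝓝 0) := by
    have := tendsto_integral_of_dominated_convergence (μ := μ.restrict Q)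
      (F := fun n Y => densityBelow {m | Y ∈ W m} n) (f := fun _ => (0 : ℝ)) (fun _ => 1)
      (fun n => (hmeas n).aestronglyMeasurable) (integrable_const _)
      (fun n => Eventually.of_forall fun Y => ?_) ((ae_restrict_iff' hQ).2 (Eventually.of_forall hd))
    · simpa using this
    · rw [Real.norm_of_nonneg (by unfold densityBelow; positivity), hsum]
      refine div_le_one_of_le₀ ?_ (Nat.cast_nonneg n)
      calc _ ≤ ∑ m ∈ Finset.range n, (1 : ℝ) := Finset.sum_le_sum fun m _ =>
            Set.indicator_le_self' (fun _ _ => zero_le_one) Y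
        _ = n := by simp
  -- A Markov-type bound: each `m` in `S` adds at least `δ` to the sum of measures.
  have hle (n : ℕ) : densityBelow S n ≤ δ⁻¹ * ∫ Y in Q, densityBelow {m | Y ∈ W m} n ∂μ := by
    rw [hint, densityBelow_eq_sum, ← mul_div_assoc, Finset.mul_sum]
    refine div_le_div_of_nonneg_right (Finset.sum_le_sum fun m _ => ?_) (Nat.cast_nonneg n)
    split_ifs with hm
    · rw [← inv_mul_cancel₀ hδ.ne']
      exact mul_le_mul_of_nonneg_left (hS m hm) (inv_nonneg.2 hδ.le)
    · positivity
  refine squeeze_zero (fun n => by unfold densityBelow; positivity) hle ?_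
  simpa using hlim.const_mul δ⁻¹

/-- If the class of points along which `G` computes a coarse description of `A` has positive
measure, then `A` is coarsely computable. -/
theorem coarselyComputable_of_measure_ne_zero {A : Set ℕ} {G : List Bool → ℕ → Option Bool}
    (hG : Primrec₂ G) (hm : PrefixMonotone G) (hpos : cantorMeasure (descriptionClass G A) ≠ 0) :
    CoarselyComputable A := by
  classical
  have hP : MeasurableSet (descriptionClass G A) :=
    (isPiThreeClass_descriptionClass hG hm).measurableSet
  obtain ⟨N, l, hl, hN, hlt⟩ := exists_prefixSet_of_pos hP hpos
  have hvote (m : ℕ) : (Nat.rfindOpt (vote G l m)).Dom := by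
    obtain ⟨s, hs⟩ := exists_isSome_vote hm hl hN (P := descriptionClass G A) (m := m)
      (fun Y hY => hY.1 m) hlt
    obtain ⟨v, hv⟩ := Option.isSome_iff_exists.1 hs
    exact Nat.rfindOpt_dom.2 ⟨s, v, hv⟩
  let D : Set ℕ := {m | (Nat.rfindOpt (vote G l m)).get (hvote m) = true}
  have hD (m : ℕ) : chi D m ∈ Nat.rfindOpt (vote G l m) := by
    have : chi D m = (Nat.rfindOpt (vote G l m)).get (hvote m) := by
      simp [chi, D]
    rw [this]
    exact Part.get_mem _
  refine ⟨D, ⟨fun m => Classical.dec _, ?_⟩, ?_⟩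
  · refine ((Partrec.rfindOpt (primrec_vote (l := l) hG).to_comp).of_eq_tot hD).of_eq fun m => ?_
    simp only [chi]
  -- A null clopen set would violate the strict inequality `hlt`.
  · have hC : 0 < cantorMeasure.real (prefixSet l N) := by
      have h1 : cantorMeasure.real (descriptionClass G A ∩ prefixSet l N) ≤
        cantorMeasure.real (prefixSet l N) := measureReal_mono Set.inter_subset_right
      linarith [measureReal_nonneg (μ := cantorMeasure) (s := prefixSet l N)]
    refine hasDensity_zero_of_le_measureReal (μ := cantorMeasure)
      (W := fun m => {Y | m ∈ errorSet G A Y}) (hP.inter (measurableSet_prefixSet l N))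
      (measurableSet_mem_errorSet G A) (fun Y hY => hY.1.2)
      (div_pos hC (by norm_num : (0 : ℝ) < 12)) fun m hmD => ?_
    obtain ⟨s, hs⟩ := Nat.rfindOpt_spec (hD m)
    have hne : chi D m = !chi A m := by
      rcases Set.mem_symmDiff.1 hmD with ⟨h1, h2⟩ | ⟨h1, h2⟩ <;> simp [chi, h1, h2]
    exact measureReal_errorSet_of_vote hl hN hP hlt (s := s) (by rw [← hne]; exact hs)

/-- No weakly `3`-random set relative to `A` computes a coarse description of `A`, unless `A` is
coarsely computable. -/
theorem WeaklyThreeRandom.not_exists_coarseDescription {A X : Set ℕ} (hA : ¬ CoarselyComputable A)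
    (hX : WeaklyThreeRandom X A) :
    ¬ ∃ D : Set ℕ, IsCoarseDescription D A ∧ SetTuringReducible D X := by
  rintro ⟨D, hDA, hDX⟩
  obtain ⟨G, hG, hm, hGD⟩ := hDX.exists_prefixMonotone
  refine hX _ (isPiThreeClass_descriptionClass (A := A) hG hm)
    (not_not.1 fun h => hA (coarselyComputable_of_measure_ne_zero hG hm h)) ⟨fun m => ?_, ?_⟩
  · obtain ⟨s, hs⟩ := hGD m
    exact ⟨s, by rw [hs]; rfl⟩
  -- Prefix monotonicity makes the value along `X` unique, so errors are exactly disagreements of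
  -- `D` with `A`.
  · have : errorSet G A (chi X) = symmDiff D A := by
      ext m
      have h1 : m ∈ errorSet G A (chi X) ↔ chi D m = !chi A m := by
        obtain ⟨s, hs⟩ := hGD m
        constructor
        · rintro ⟨t, ht⟩
          have h2 := hm.initSeg ht (le_max_right s t)
          rw [hm.initSeg hs (le_max_left s t)] at h2
          exact Option.some.inj h2
        · exact fun h => ⟨s, by rw [hs, h]⟩
      rw [h1, Set.mem_symmDiff]
      by_cases hD : m ∈ D <;> by_cases hA' : m ∈ A <;> simp [chi, hD, hA']
    rw [this]
    exact hDA

lemma isCoarseDescription_self (X : Set ℕ) : IsCoarseDescription X X := by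
  have h : densityBelow (∅ : Set ℕ) = fun _ => 0 := by
    ext n; simp [densityBelow]
  rw [IsCoarseDescription, HasDensity, symmDiff_self, Set.bot_eq_empty, h]
  exact tendsto_const_nhds

end CoarseReducibility

theorem mainTheorem8 (A X : Set ℕ)
    (hA : ¬ CoarseReducibility.CoarselyComputable A)
    (hX : CoarseReducibility.WeaklyThreeRandom X A) :
    (¬ ∃ D : Set ℕ, CoarseReducibility.IsCoarseDescription D A ∧
        CoarseReducibility.SetTuringReducible D X) ∧
      ¬ CoarseReducibility.NonuniformlyCoarselyReducible A X :=
  have h := hX.not_exists_coarseDescription hA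
  ⟨h, fun hnc => h (hnc X (CoarseReducibility.isCoarseDescription_self X))⟩
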